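/- Let $k$ be a field of characteristic zero and let $k_0 \subseteq k$ be a computable subfield, that is, a subfield given with a surjection $\nu \colon \mathbb{N} \to k_0$ such that addition and multiplication of $k_0$ are computable on names (there are computable $s, p \colon \mathbb{N}^2 \to \mathbb{N}$ with $\nu(s(i,j)) = \nu(i) + \nu(j)$ and $\nu(p(i,j)) = \nu(i)\nu(j)$) and the relation $\nu(i) = \nu(j)$ is decidable. Let $M_2$ be the free monoid on two generators. Let $k^{M_2}$ be the ring of all maps $M_2 \to k$ with componentwise operations, on which $M_2$ acts by $\sigma^m\bigl((x_\ell)_{\ell \in M_2}\bigr) = (x_{\ell m})_{\ell \in M_2}$. An $M_2$-polynomial over $k_0$ in the unknowns $X_1, \ldots, X_n$ is an element $f$ of the polynomial ring $k_0[\sigma^m(X_i) \mid 1 \leqslant i \leqslant n,\ m \in M_2]$; its value $f(\mathbf{x}) \in k^{M_2}$ at $\mathbf{x} = (x_1, \ldots, x_n) \in (k^{M_2})^n$ is obtained by substituting $\sigma^m(x_i)$ for each indeterminate $\sigma^m(X_i)$ and constant sequences for the elements of $k_0$. A solution of $F = 0$ in $k^{M_2}$ is an $\mathbf{x} \in (k^{M_2})^n$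 with $f(\mathbf{x}) = 0$ for all $f \in F$. Then the following problem is undecidable: given $n \in \mathbb{N}$ and a finite set $F$ of $M_2$-polynomials over $k_0$ in $n$ unknowns (each written as a finite sum of terms, with coefficients given by their names under $\nu$), decide whether $F = 0$ has a solution in $k^{M_2}$. -/

import Mathlib

/-- The action `σ` of a monoid `M` on the ring `R^M = (M → R)` of `M`-sequences (with componentwise
operations): `σ^m ((x_ℓ)_ℓ) = (x_{ℓ m})_ℓ`. It is an action by ring endomorphisms, that is, a monoid
homomorphism from `M` to the ring endomorphisms of `R^M` under composition. -/
def sequenceShift (M R : Type*) [Monoid M] [CommRing R] :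
    M →* ((M → R) →+* (M → R)) where
  toFun m :=
    { toFun := fun x l => x (l * m)
      map_one' := rfl
      map_mul' := fun _ _ => rfl
      map_zero' := rfl
      map_add' := fun _ _ => rfl }
  map_one' := by
    ext x l
    simp
  map_mul' m₁ m₂ := by
    ext x l
    simp [mul_assoc]

/-- The ring `R[σ^m(X_i) | i ∈ ι, m ∈ M]` of `M`-polynomials over `R` in the unknowns `X_i`, `i ∈ ι`:
the polynomial ring in the indeterminates `σ^m(X_i)`; the pair `(i, m)` stands for `σ^m(X_i)`. -/
abbrev MPolynomial (M ι R : Type*) [CommRing R] : Type _ :=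
  MvPolynomial (ι × M) R

/-- The value `f(x) ∈ K^M` of an `M`-polynomial `f` over `R` at a tuple `x` of `M`-sequences over the
`R`-algebra `K`: constants go to constant sequences and `σ^m(X_i)` goes to `σ^m(x_i)`. -/
noncomputable def MPolynomial.value {M ι R K : Type*} [Monoid M] [CommRing R] [CommRing K]
    [Algebra R K] (f : MPolynomial M ι R) (x : ι → M → K) : M → K :=
  MvPolynomial.aeval (fun v : ι × M => sequenceShift M K v.2 (x v.1)) f

/-- The system `F = 0` of `M`-polynomials over `R` has a solution in `K^M`. -/
def HasSequenceSolution {M ι R : Type*} (K : Type*) [Monoid M] [CommRing R] [CommRing K]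
    [Algebra R K] (F : Set (MPolynomial M ι R)) : Prop :=
  ∃ x : ι → M → K, ∀ f ∈ F, MPolynomial.value f x = 0

/-- `ν : ℕ → A` is a computable presentation of the field `A`: every element has a name, addition and
multiplication are computable on names, and equality of named elements is decidable. (Names of
negatives and inverses can then be computed by search.) -/
structure IsComputablePresentation {A : Type*} [Field A] (ν : ℕ → A) : Prop where
  surjective : Function.Surjective ν
  add : ∃ s : ℕ → ℕ → ℕ, Computable₂ s ∧ ∀ i j, ν (s i j) = ν i + ν j
  mul : ∃ p : ℕ → ℕ → ℕ, Computable₂ p ∧ ∀ i j, ν (p i j) = ν i * ν j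
  eq : ComputablePred (fun q : ℕ × ℕ => ν q.1 = ν q.2)

/-- The free monoid on two generators: words in the two letters `false` and `true`. -/
abbrev M₂ : Type := FreeMonoid Bool

/-- A power `σ^w(X_i)^e` is written as `((i, w), e)`. -/
abbrev PowerCode : Type := (ℕ × List Bool) × ℕ

/-- A term is written as a name of its coefficient with a list of powers to be multiplied. -/
abbrev TermCode : Type := ℕ × List PowerCode

/-- An `M₂`-polynomial is written as a list of terms to be added. -/
abbrev PolyCode : Type := List TermCode

/-- A finite system of `M₂`-polynomials is written as the number of unknowns with the list of its
members. -/
abbrev SystemCode : Type := ℕ × List PolyCode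

/-- The power denoted by a code, in the unknowns `X_0, X_1, …`. -/
noncomputable def PowerCode.denote (A : Type*) [CommRing A] (c : PowerCode) : MPolynomial M₂ ℕ A :=
  MvPolynomial.X (c.1.1, FreeMonoid.ofList c.1.2) ^ c.2

/-- The term denoted by a code, where `ν` interprets names of coefficients. -/
noncomputable def TermCode.denote {A : Type*} [CommRing A] (ν : ℕ → A) (c : TermCode) :
    MPolynomial M₂ ℕ A :=
  MvPolynomial.C (ν c.1) * (c.2.map (PowerCode.denote A)).prod

/-- The `M₂`-polynomial denoted by a code. -/
noncomputable def PolyCode.denote {A : Type*} [CommRing A] (ν : ℕ → A) (c : PolyCode) :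
    MPolynomial M₂ ℕ A :=
  (c.map (TermCode.denote ν)).sum

/-- The inclusion of the `M`-polynomials in `X_0, …, X_{n-1}` into those in `X_0, X_1, …`. -/
noncomputable def MPolynomial.includeVars {M A : Type*} [CommRing A] {n : ℕ}
    (f : MPolynomial M (Fin n) A) : MPolynomial M ℕ A :=
  MvPolynomial.rename (fun v : Fin n × M => ((v.1 : ℕ), v.2)) f

/-- The code `c` is a code of the finite set `F` of `M₂`-polynomials in `n` unknowns: it records `n`,
and the polynomials it lists are exactly the members of `F` (in any order, possibly repeated). -/
def SystemCode.Represents {A : Type*} [CommRing A] (ν : ℕ → A) (c : SystemCode) {n : ℕ}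
    (F : Finset (MPolynomial M₂ (Fin n) A)) : Prop :=
  c.1 = n ∧ MPolynomial.includeVars '' (F : Set (MPolynomial M₂ (Fin n) A)) =
    {p | ∃ d ∈ c.2, PolyCode.denote ν d = p}

/-- There is an algorithm that, given a code of a finite set `F` of `M₂`-polynomials over `A` in
finitely many unknowns, decides whether `F = 0` has a solution in `K^{M₂}`. Nothing is asked of the
algorithm on inputs that code no system, except that it halts. -/
def M₂SolvabilityDecidable (K : Type*) [CommRing K] {A : Type*} [CommRing A] [Algebra A K]
    (ν : ℕ → A) : Prop :=
  ∃ D : SystemCode → Bool, Computable D ∧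
    ∀ (n : ℕ) (F : Finset (MPolynomial M₂ (Fin n) A)) (c : SystemCode), c.Represents ν F →
      (D c = true ↔ HasSequenceSolution K (F : Set (MPolynomial M₂ (Fin n) A)))

/-! Non-halting is reduced to solvability. A sequence on the free monoid assigns a value to each
word, and the equations relate the values at `l`, `l * τ` and `l * φ`, where `τ`, `φ` are the two
letters. As the monoid is free, every word `l` has room for a computation of its own: `τ` starts it
with data read at `l`, and each `φ` advances it. Hence primitive recursion can be carried out by
equations, and every primitive recursive function is representable (`IsRepresentable.prec`,
`IsRepresentable.of_primrec`).

A sequence reset to `0` by `τ` and increased by `1` by `φ` runs through all natural numbers, so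
requiring a represented `g c t` to be invertible at every word says that it never vanishes
(`Primrec₂.exists_isMDefinable`). With `g c t = 0` meaning that program `c` halts within bound `t`,
one fixed system together with the equation `X_i = c` is solvable exactly when `c` does not halt. -/

theorem sequenceShift_apply {M R : Type*} [Monoid M] [CommRing R] (m : M) (x : M → R) (l : M) :
    sequenceShift M R m x l = x (l * m) :=
  rfl

/-! ### Polynomial maps and definable sets of sequences -/

/-- A map from tuples of sequences to sequences that is given by an `M`-polynomial. -/
def IsMPolynomialMap {M α K : Type*} (R : Type*) [Monoid M] [CommRing R] [CommRing K] [Algebra R K]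
    (t : (α → M → K) → M → K) : Prop :=
  ∃ p : MPolynomial M α R, ∀ x, p.value x = t x

namespace IsMPolynomialMap

variable {M α R K : Type*} [Monoid M] [CommRing R] [CommRing K] [Algebra R K]
  {s t : (α → M → K) → M → K}

theorem shift (i : α) (m : M) :
    IsMPolynomialMap R (fun (x : α → M → K) => sequenceShift M K m (x i)) :=
  ⟨MvPolynomial.X (i, m), fun x => by simp [MPolynomial.value]⟩

theorem var (i : α) : IsMPolynomialMap R (fun (x : α → M → K) => x i) := by
  simpa using shift (R := R) (K := K) i (1 : M)

theorem add (hs : IsMPolynomialMap R s) (ht : IsMPolynomialMap R t) :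
    IsMPolynomialMap R (fun x => s x + t x) := by
  obtain ⟨p, hp⟩ := hs
  obtain ⟨q, hq⟩ := ht
  exact ⟨p + q, fun x => by simp [← hp, ← hq, MPolynomial.value]⟩

theorem sub (hs : IsMPolynomialMap R s) (ht : IsMPolynomialMap R t) :
    IsMPolynomialMap R (fun x => s x - t x) := by
  obtain ⟨p, hp⟩ := hs
  obtain ⟨q, hq⟩ := ht
  exact ⟨p - q, fun x => by simp [← hp, ← hq, MPolynomial.value]⟩

theorem mul (hs : IsMPolynomialMap R s) (ht : IsMPolynomialMap R t) :
    IsMPolynomialMap R (fun x => s x * t x) := by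
  obtain ⟨p, hp⟩ := hs
  obtain ⟨q, hq⟩ := ht
  exact ⟨p * q, fun x => by simp [← hp, ← hq, MPolynomial.value]⟩

theorem zero : IsMPolynomialMap R (fun _ : α → M → K => (0 : M → K)) :=
  ⟨0, fun x => by simp [MPolynomial.value]⟩

theorem one : IsMPolynomialMap R (fun _ : α → M → K => (1 : M → K)) :=
  ⟨1, fun x => by simp [MPolynomial.value]⟩

end IsMPolynomialMap

theorem MPolynomial.value_rename {M α β R K : Type*} [Monoid M] [CommRing R] [CommRing K]
    [Algebra R K] (e : α → β) (f : MPolynomial M α R) (x : β → M → K) :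
    MPolynomial.value (MvPolynomial.rename (Prod.map e id) f : MPolynomial M β R) x =
      f.value (x ∘ e) := by
  simp only [MPolynomial.value, MvPolynomial.aeval_rename]
  rfl

/-- A set of tuples of sequences that is a projection of the solution set of a finite system of
`M`-polynomials over `R`. -/
def IsMDefinable {M K : Type*} {α : Type} (R : Type*) [Monoid M] [CommRing R] [CommRing K]
    [Algebra R K] (S : Set (α → M → K)) : Prop :=
  ∃ (β : Type) (_ : Finite β) (F : Set (MPolynomial M (α ⊕ β) R)), F.Finite ∧
    ∀ x, x ∈ S ↔ ∃ y : β → M → K, ∀ f ∈ F, f.value (Sum.elim x y) = 0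

namespace IsMDefinable

variable {M R K : Type*} {α β : Type} [Monoid M] [CommRing R] [CommRing K] [Algebra R K]

theorem eq {s t : (α → M → K) → M → K} (hs : IsMPolynomialMap R s) (ht : IsMPolynomialMap R t) :
    IsMDefinable R {x | s x = t x} := by
  obtain ⟨p, hp⟩ := hs.sub ht
  refine ⟨Empty, inferInstance, {MvPolynomial.rename (Prod.map Sum.inl id) p},
    Set.finite_singleton _, fun x => ?_⟩
  have h (y : Empty → M → K) : MPolynomial.value (MvPolynomial.rename (Prod.map Sum.inl id) p :
      MPolynomial M (α ⊕ Empty) R) (Sum.elim x y) = s x - t x := by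
    rw [MPolynomial.value_rename, Sum.elim_comp_inl, hp]
  simp [h, sub_eq_zero]

/-- The auxiliary unknowns of the different systems are kept apart by a disjoint union. -/
theorem iInter {ι : Type} [Finite ι] {S : ι → Set (α → M → K)} (h : ∀ i, IsMDefinable R (S i)) :
    IsMDefinable R {x | ∀ i, x ∈ S i} := by
  choose β hβ F hF h using h
  let e (i : ι) : α ⊕ β i → α ⊕ (Σ i, β i) := Sum.map id (Sigma.mk i)
  refine ⟨Σ i, β i, inferInstance,
    ⋃ i, MvPolynomial.rename (Prod.map (e i) id) '' F i,
    Set.finite_iUnion fun i => (hF i).image _, fun x => ?_⟩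
  have he (i : ι) (y : (Σ i, β i) → M → K) :
      Sum.elim x y ∘ e i = Sum.elim x fun b => y ⟨i, b⟩ := by
    ext (_ | _) <;> rfl
  simp only [Set.mem_ofPred_eq, h, Set.mem_iUnion, Set.mem_image]
  constructor
  · intro hx
    choose y hy using hx
    refine ⟨fun b => y b.1 b.2, ?_⟩
    rintro _ ⟨i, f, hf, rfl⟩
    rw [MPolynomial.value_rename, he]
    exact hy i f hf
  · rintro ⟨y, hy⟩ i
    refine ⟨fun b => y ⟨i, b⟩, fun f hf => ?_⟩
    rw [← he, ← MPolynomial.value_rename]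
    exact hy _ ⟨i, f, hf, rfl⟩

theorem inter {S T : Set (α → M → K)} (hS : IsMDefinable R S) (hT : IsMDefinable R T) :
    IsMDefinable R {x | x ∈ S ∧ x ∈ T} := by
  have h := iInter (S := fun b : Bool => if b then S else T) (R := R) (by simp [hS, hT])
  simpa [and_comm] using h

theorem preimage {S : Set (α → M → K)} (hS : IsMDefinable R S) (e : α → β) :
    IsMDefinable R {x : β → M → K | x ∘ e ∈ S} := by
  obtain ⟨γ, hγ, F, hF, h⟩ := hS
  refine ⟨γ, hγ, MvPolynomial.rename (Prod.map (Sum.map e id) id) '' F, hF.image _, fun x => ?_⟩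
  have he (y : γ → M → K) : Sum.elim x y ∘ Sum.map e id = Sum.elim (x ∘ e) y := by
    ext (_ | _) <;> rfl
  simp only [Set.mem_ofPred_eq, h, Set.forall_mem_image, MPolynomial.value_rename, he]

theorem exists_tuple [Finite β] {S : Set (α ⊕ β → M → K)} (hS : IsMDefinable R S) :
    IsMDefinable R {x : α → M → K | ∃ y : β → M → K, Sum.elim x y ∈ S} := by
  obtain ⟨γ, hγ, F, hF, h⟩ := hS
  refine ⟨β ⊕ γ, inferInstance, MvPolynomial.rename (Prod.map (Equiv.sumAssoc α β γ) id) '' F,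
    hF.image _, fun x => ?_⟩
  have he (y : β → M → K) (z : γ → M → K) :
      Sum.elim x (Sum.elim y z) ∘ Equiv.sumAssoc α β γ = Sum.elim (Sum.elim x y) z := by
    ext ((_ | _) | _) <;> rfl
  simp only [Set.mem_ofPred_eq, h, Set.forall_mem_image, MPolynomial.value_rename]
  constructor
  · rintro ⟨y, z, hz⟩
    exact ⟨Sum.elim y z, by simpa only [he] using hz⟩
  · rintro ⟨w, hw⟩
    refine ⟨w ∘ Sum.inl, w ∘ Sum.inr, ?_⟩
    rw [← Sum.elim_comp_inl_inr w] at hw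
    simpa only [he] using hw

end IsMDefinable

/-! ### Representing primitive recursive functions -/

/-- A function on words can be defined by restarting it on the words that end in `true` and iterating
a map along the letter `false`. -/
theorem exists_restart_iterate {T : Type*} [Nonempty T] (u : M₂ → T) (s : T → T) :
    ∃ F : M₂ → T, (∀ l, F (l * FreeMonoid.of true) = u l) ∧
      ∀ l, F (l * FreeMonoid.of false) = s (F l) := by
  -- The recursion runs on the reversed word, since the last letter decides; only the empty word is
  -- unconstrained.
  let G : List Bool → T := fun l => List.rec (Classical.arbitrary T)
    (fun b r ih => if b then u (FreeMonoid.ofList r.reverse) else s ih) l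
  refine ⟨fun l => G l.toList.reverse, fun l => ?_, fun l => ?_⟩ <;>
    simp [G]

/-- A function of natural numbers whose values are forced, at all words where the arguments are
natural numbers, by a system of `M₂`-polynomials that is solvable for arbitrary natural arguments. -/
def IsRepresentable (R K : Type*) [CommRing R] [CommRing K] [Algebra R K] {n : ℕ}
    (f : List.Vector ℕ n → ℕ) : Prop :=
  ∃ S : Set (Option (Fin n) → M₂ → K), IsMDefinable R S ∧
    (∀ x ∈ S, ∀ l v, (∀ i, x (some i) l = ((v.get i : ℕ) : K)) →
      x none l = ((f v : ℕ) : K)) ∧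
    ∀ x (a : M₂ → List.Vector ℕ n), (∀ i l, x (some i) l = (((a l).get i : ℕ) : K)) →
      (∀ l, x none l = ((f (a l) : ℕ) : K)) → x ∈ S

namespace IsRepresentable

variable {R K : Type*} [CommRing R] [Field K] [Algebra R K]

theorem zero : IsRepresentable R K (n := 0) fun _ => 0 := by
  refine ⟨_, .eq (.var none) .zero, ?_, ?_⟩
  · intro x hx l v _
    simpa using congrFun hx l
  · intro x a _ h
    ext l
    simpa using h l

theorem succ : IsRepresentable R K (n := 1) fun v => v.head.succ := by
  refine ⟨_, .eq (.var none) (.add (.var (some 0)) .one), ?_, ?_⟩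
  · intro x hx l v h
    have := congrFun hx l
    simp_all
  · intro x a h h'
    ext l
    simp [h, h']

theorem get {n : ℕ} (i : Fin n) : IsRepresentable R K fun v => v.get i := by
  refine ⟨_, .eq (.var none) (.var (some i)), ?_, ?_⟩
  · intro x hx l v h
    have := congrFun hx l
    simp_all
  · intro x a h h'
    ext l
    simp [h, h']

theorem comp {m n : ℕ} {f : List.Vector ℕ n → ℕ} {g : Fin n → List.Vector ℕ m → ℕ}
    (hf : IsRepresentable R K f) (hg : ∀ i, IsRepresentable R K (g i)) :
    IsRepresentable R K fun a => f (List.Vector.ofFn fun i => g i a) := by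
  obtain ⟨S, hS, hSf, hfS⟩ := hf
  choose T hT hTg hgT using hg
  refine ⟨_, (IsMDefinable.inter
    (hS.preimage (β := Option (Fin m) ⊕ Fin n) fun o => o.elim (.inl none) .inr)
    (IsMDefinable.iInter fun i => (hT i).preimage (β := Option (Fin m) ⊕ Fin n)
      fun o => o.elim (.inr i) fun j => .inl (some j))).exists_tuple, ?_, ?_⟩
  · rintro x ⟨y, hy, hy'⟩ l v h
    refine hSf _ hy l _ fun i => ?_
    simpa using hTg i _ (hy' i) l v h
  · intro x a h h'
    refine ⟨fun i l => ((g i (a l) : ℕ) : K), ?_, fun i => ?_⟩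
    · exact hfS _ (fun l => List.Vector.ofFn fun i => g i (a l)) (fun i l => by simp)
        fun l => by simpa using h' l
    · exact hgT i _ a (fun j l => by simpa using h j l) fun l => by simp

end IsRepresentable

namespace IsRepresentable

variable {R K : Type*} [CommRing R] [Field K] [Algebra R K]

/-- The recursion at `l` is unwound along `l * τ`, `l * τ * φ`, …: the parameters stay fixed and the
counter drops by one per `φ`, until the base case applies at counter `0`. -/
theorem prec [CharZero K] {n : ℕ} {f : List.Vector ℕ n → ℕ} {g : List.Vector ℕ (n + 2) → ℕ}
    (hf : IsRepresentable R K f) (hg : IsRepresentable R K g) :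
    IsRepresentable R K fun v : List.Vector ℕ (n + 1) =>
      v.head.rec (f v.tail) fun y ih => g (y ::ᵥ ih ::ᵥ v.tail) := by
  obtain ⟨S, hS, hSf, hfS⟩ := hf
  obtain ⟨T, hT, hTg, hgT⟩ := hg
  let V := Option (Fin (n + 1)) ⊕ (Fin n ⊕ Fin 8)
  -- Parameters `A`, counter `N`, its predecessor `P`, indicator `Z` of `N = 0` with witness `W`,
  -- values `Q` and `Y` of the recursion at `P` and `N`, base value `G`, step value `H`.
  let A (i : Fin n) : V := .inr (.inl i)
  let N : V := .inr (.inr 0)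
  let P : V := .inr (.inr 1)
  let Z : V := .inr (.inr 2)
  let W : V := .inr (.inr 3)
  let Q : V := .inr (.inr 4)
  let Y : V := .inr (.inr 5)
  let G : V := .inr (.inr 6)
  let H : V := .inr (.inr 7)
  let τ : M₂ := .of true
  let φ : M₂ := .of false
  let eS : Option (Fin n) → V := fun o => o.elim G A
  let eT : Option (Fin (n + 2)) → V :=
    fun o => o.elim H fun i => Fin.cases P (fun j => Fin.cases Q A j) i
  have h_restart : IsMDefinable R {x : V → M₂ → K |
      (∀ i, sequenceShift M₂ K τ (x (A i)) = x (.inl (some i.succ))) ∧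
      (∀ i, sequenceShift M₂ K φ (x (A i)) = x (A i)) ∧
      sequenceShift M₂ K τ (x N) = x (.inl (some 0)) ∧
      sequenceShift M₂ K φ (x N) = x P ∧
      sequenceShift M₂ K φ (x Y) = x Q ∧
      sequenceShift M₂ K τ (x Y) = x (.inl none)} :=
    .inter (.iInter fun i => .eq (.shift _ _) (.var _)) <|
    .inter (.iInter fun i => .eq (.shift _ _) (.var _)) <|
    .inter (.eq (.shift _ _) (.var _)) <| .inter (.eq (.shift _ _) (.var _)) <|
    .inter (.eq (.shift _ _) (.var _)) (.eq (.shift _ _) (.var _))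
  have h_step : IsMDefinable R {x : V → M₂ → K |
      x Z * x N = 0 ∧ x N * x W = 1 - x Z ∧ x P = x N - 1 + x Z ∧
      x Y = x Z * x G + (1 - x Z) * x H} :=
    -- Over a field, the first two equations force `Z` to be `1` where `N = 0` and `0` elsewhere.
    .inter (.eq (.mul (.var _) (.var _)) .zero) <|
    .inter (.eq (.mul (.var _) (.var _)) (.sub .one (.var _))) <|
    .inter (.eq (.var _) (.add (.sub (.var _) .one) (.var _)))
      (.eq (.var _) (.add (.mul (.var _) (.var _)) (.mul (.sub .one (.var _)) (.var _))))
  refine ⟨_, (IsMDefinable.inter (h_restart.inter h_step)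
    ((hS.preimage eS).inter (hT.preimage eT))).exists_tuple, ?_, ?_⟩
  · rintro x ⟨y, ⟨⟨hAτ, hAφ, hNτ, hNφ, hYφ, hYτ⟩, hZN, hNW, hP, hY⟩, hyS, hyT⟩ l v hv
    simp only [V, A, N, P, Z, W, Q, Y, G, H, Sum.elim_inl, Sum.elim_inr] at *
    -- The word must vary in the induction on the counter: the step passes from `l'` to `l' * φ`.
    have key (j : ℕ) : ∀ l', y (.inr 0) l' = j → (∀ i, y (.inl i) l' = ((v.tail.get i : ℕ) : K)) →
        y (.inr 5) l' =
          ((j.rec (f v.tail) fun y ih => g (y ::ᵥ ih ::ᵥ v.tail) : ℕ) : K) := by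
      induction j with
      | zero =>
        intro l' hj hA
        have hZ : y (.inr 2) l' = 1 := by
          have := congrFun hNW l'
          simp only [Pi.mul_apply, Pi.sub_apply, Pi.one_apply, hj] at this
          push_cast at this
          linear_combination this
        have hG := hSf _ hyS l' v.tail hA
        have hG' : y (.inr 6) l' = ((f v.tail : ℕ) : K) := hG
        have := congrFun hY l'
        simpa [hZ, hG'] using this
      | succ j ih =>
        intro l' hj hA
        have hZ : y (.inr 2) l' = 0 := by
          have := congrFun hZN l'
          simp only [Pi.mul_apply, Pi.zero_apply, hj, mul_eq_zero] at this
          exact this.resolve_right (Nat.cast_ne_zero.2 j.succ_ne_zero)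
        have hPj : y (.inr 1) l' = j := by
          have := congrFun hP l'
          simpa [hZ, hj] using this
        have hQ : y (.inr 4) l' =
            ((j.rec (f v.tail) fun y ih => g (y ::ᵥ ih ::ᵥ v.tail) : ℕ) : K) := by
          rw [← congrFun hYφ l']
          refine ih (l' * φ) ?_ fun i => ?_
          · rw [← hPj, ← congrFun hNφ l']
            rfl
          · rw [← hA i]
            exact congrFun (hAφ i) l'
        have hH := hTg _ hyT l'
          (j ::ᵥ (j.rec (f v.tail) fun y ih => g (y ::ᵥ ih ::ᵥ v.tail)) ::ᵥ v.tail) fun i => by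
            refine Fin.cases ?_ (fun i => Fin.cases ?_ (fun i => ?_) i) i
            · exact hPj
            · exact hQ
            · exact hA i
        have hH' : y (.inr 7) l' = ((g (j ::ᵥ (j.rec (f v.tail) fun y ih =>
          g (y ::ᵥ ih ::ᵥ v.tail)) ::ᵥ v.tail) : ℕ) : K) := hH
        have := congrFun hY l'
        simpa [hZ, hH'] using this
    rw [← congrFun hYτ l]
    refine key v.head (l * τ) ?_ fun i => ?_
    · have := hv 0
      rw [← congrFun hNτ l] at this
      simpa [sequenceShift_apply] using this
    · have := hv i.succ
      rw [← congrFun (hAτ i) l] at this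
      simpa [sequenceShift_apply] using this
  · intro x a hx hx'
    -- `F` holds counter and parameters. Truncated subtraction keeps an exhausted counter at `0`, in
    -- agreement with `P = N - 1 + Z`.
    obtain ⟨F, hFτ, hFφ⟩ := exists_restart_iterate a fun v => (v.head - 1) ::ᵥ v.tail
    obtain ⟨r, hr⟩ : ∃ r : List.Vector ℕ n → ℕ → ℕ, ∀ v j,
        r v j = j.rec (f v) fun y ih => g (y ::ᵥ ih ::ᵥ v) := ⟨_, fun _ _ => rfl⟩
    let p : Fin 8 → M₂ → K := ![
      fun l => (((F l).head : ℕ) : K),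
      fun l => (((F l).head - 1 : ℕ) : K),
      fun l => if (F l).head = 0 then 1 else 0,
      fun l => ((F l).head : K)⁻¹,
      fun l => ((r (F l).tail ((F l).head - 1) : ℕ) : K),
      fun l => ((r (F l).tail (F l).head : ℕ) : K),
      fun l => ((f (F l).tail : ℕ) : K),
      fun l => ((g (((F l).head - 1) ::ᵥ r (F l).tail ((F l).head - 1) ::ᵥ (F l).tail) : ℕ) : K)]
    refine ⟨Sum.elim (fun i l => (((F l).tail.get i : ℕ) : K)) p,
      ⟨⟨fun i => ?_, fun i => ?_, ?_, ?_, ?_, ?_⟩, ?_, ?_, ?_, ?_⟩, ?_, ?_⟩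
    · ext l
      change (((F (l * τ)).tail.get i : ℕ) : K) = x (some i.succ) l
      rw [hFτ, hx]
      simp
    · ext l
      change (((F (l * φ)).tail.get i : ℕ) : K) = (((F l).tail.get i : ℕ) : K)
      rw [hFφ]
      simp
    · ext l
      change (((F (l * τ)).head : ℕ) : K) = x (some 0) l
      rw [hFτ, hx]
      simp
    · ext l
      change (((F (l * φ)).head : ℕ) : K) = (((F l).head - 1 : ℕ) : K)
      rw [hFφ]
      simp
    · ext l
      change ((r (F (l * φ)).tail (F (l * φ)).head : ℕ) : K) =
        ((r (F l).tail ((F l).head - 1) : ℕ) : K)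
      rw [hFφ]
      simp
    · ext l
      change ((r (F (l * τ)).tail (F (l * τ)).head : ℕ) : K) = x none l
      rw [hFτ, hx', hr]
    · ext l
      change (if (F l).head = 0 then (1 : K) else 0) * ((F l).head : ℕ) = 0
      split_ifs with h <;> simp [h]
    · ext l
      change (((F l).head : ℕ) : K) * ((F l).head : K)⁻¹ = 1 - if (F l).head = 0 then (1 : K) else 0
      split_ifs with h <;> simp [h]
    · ext l
      change (((F l).head - 1 : ℕ) : K) =
        ((F l).head : ℕ) - 1 + if (F l).head = 0 then (1 : K) else 0
      cases h : (F l).head <;> simp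
    · ext l
      change ((r (F l).tail (F l).head : ℕ) : K) =
        (if (F l).head = 0 then (1 : K) else 0) * ((f (F l).tail : ℕ) : K) +
        (1 - if (F l).head = 0 then (1 : K) else 0) *
        ((g (((F l).head - 1) ::ᵥ r (F l).tail ((F l).head - 1) ::ᵥ (F l).tail) : ℕ) : K)
      cases h : (F l).head <;> simp [hr]
    · exact hfS _ (fun l => (F l).tail) (fun i l => rfl) fun l => rfl
    · refine hgT _ (fun l => ((F l).head - 1) ::ᵥ r (F l).tail ((F l).head - 1) ::ᵥ (F l).tail)
        (fun i l => ?_) fun l => rfl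
      refine Fin.cases ?_ (fun i => Fin.cases ?_ (fun i => ?_) i) i
      · simp only [List.Vector.get_zero, List.Vector.head_cons]
        rfl
      · simp only [List.Vector.get_cons_succ, List.Vector.get_zero, List.Vector.head_cons]
        rfl
      · simp only [List.Vector.get_cons_succ]
        rfl

theorem of_primrec [CharZero K] {n : ℕ} {f : List.Vector ℕ n → ℕ} (hf : Nat.Primrec' f) :
    IsRepresentable R K f := by
  induction hf with
  | zero => exact zero
  | succ => exact succ
  | get i => exact get i
  | comp g _ _ hf hg => exact hf.comp hg
  | prec _ _ hf hg => exact hf.prec hg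

end IsRepresentable

/-! ### Universal quantification and the halting problem -/

/-- For primitive recursive `g`, the set of the `c` such that `g c t` never vanishes is cut out by a
definable set of sequences. -/
theorem Primrec₂.exists_isMDefinable {g : ℕ → ℕ → ℕ} (hg : Primrec₂ g) (R K : Type*) [CommRing R]
    [Field K] [CharZero K] [Algebra R K] :
    ∃ S : Set (Unit → M₂ → K), IsMDefinable R S ∧
      ∀ c : ℕ, (fun _ _ => (c : K)) ∈ S ↔ ∀ t, g c t ≠ 0 := by
  obtain ⟨S, hS, hSg, hgS⟩ := IsRepresentable.of_primrec (R := R) (K := K)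
    (Nat.Primrec'.prim_iff₂.2 hg)
  let V := Unit ⊕ Fin 3
  let T : V := .inr 0
  let G : V := .inr 1
  let I : V := .inr 2
  let τ : M₂ := .of true
  let φ : M₂ := .of false
  let e : Option (Fin 2) → V := fun o => o.elim G ![.inl (), T]
  have h : IsMDefinable R {x : V → M₂ → K | sequenceShift M₂ K τ (x T) = 0 ∧
      sequenceShift M₂ K φ (x T) = x T + 1 ∧ x G * x I = 1} :=
    .inter (.eq (.shift _ _) .zero) <| .inter (.eq (.shift _ _) (.add (.var _) .one))
      (.eq (.mul (.var _) (.var _)) .one)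
  refine ⟨_, (h.inter (hS.preimage e)).exists_tuple, fun c => ⟨?_, fun hc => ?_⟩⟩
  · rintro ⟨y, ⟨hτ, hφ, hI⟩, hy⟩ t
    simp only [V, T, G, I, Sum.elim_inr] at *
    obtain ⟨l, hl⟩ : ∃ l, y 0 l = t := by
      induction t with
      -- The value `t` is attained at the word `τφ^t`.
      | zero => exact ⟨1 * τ, (congrFun hτ 1).trans Nat.cast_zero.symm⟩
      | succ t ih =>
        obtain ⟨l, hl⟩ := ih
        exact ⟨l * φ, (congrFun hφ l).trans (by simp [hl])⟩
    have hG := hSg _ hy l (c ::ᵥ t ::ᵥ .nil) fun i => by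
      fin_cases i
      · rfl
      · exact hl
    intro h0
    have := congrFun hI l
    have hG' : y 1 l = ((g c t : ℕ) : K) := hG
    simp [hG', h0] at this
  · obtain ⟨F, hFτ, hFφ⟩ := exists_restart_iterate (fun _ => 0) Nat.succ
    refine ⟨![fun l => (F l : K), fun l => (g c (F l) : K), fun l => (g c (F l) : K)⁻¹],
      ⟨?_, ?_, ?_⟩, ?_⟩
    · ext l
      change ((F (l * τ) : ℕ) : K) = 0
      simp [τ, hFτ]
    · ext l
      change ((F (l * φ) : ℕ) : K) = (F l : K) + 1
      simp [φ, hFφ]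
    · ext l
      exact mul_inv_cancel₀ (Nat.cast_ne_zero.2 (hc _))
    · refine hgS _ (fun l => c ::ᵥ F l ::ᵥ .nil) (fun i l => ?_) fun l => rfl
      fin_cases i <;> rfl

/-- There are finitely many `M₂`-polynomials in `N` unknowns such that it is undecidable whether they
have a common solution whose first entry is a given constant natural number. -/
theorem exists_undecidable_system (R K : Type*) [CommRing R] [Field K] [CharZero K] [Algebra R K] :
    ∃ (N : ℕ) (i : Fin N) (F : Finset (MPolynomial M₂ (Fin N) R)),
      ¬ ComputablePred fun c : ℕ => ∃ x : Fin N → M₂ → K, (x i = fun _ => (c : K)) ∧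
        ∀ f ∈ F, f.value x = 0 := by
  let g (c t : ℕ) : ℕ :=
    if (Nat.Partrec.Code.evaln t (Denumerable.ofNat Nat.Partrec.Code c) 0).isSome then 0 else 1
  have hg : Primrec₂ g := by
    refine Primrec.ite (PrimrecPred.of_eq (p := fun a : ℕ × ℕ =>
      (Nat.Partrec.Code.evaln a.2 (Denumerable.ofNat Nat.Partrec.Code a.1) 0).isSome = true) ?_
      fun _ => Iff.rfl) (.const 0) (.const 1)
    exact Primrec.eq.comp (Primrec.option_isSome.comp (Nat.Partrec.Code.primrec_evaln.comp
      (.pair (.pair .snd ((Primrec.ofNat _).comp .fst)) (.const 0)))) (.const true)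
  have hg0 (c : ℕ) : (∀ t, g c t ≠ 0) ↔
      ¬ (Nat.Partrec.Code.eval (Denumerable.ofNat Nat.Partrec.Code c) 0).Dom := by
    simp only [g, Part.dom_iff_mem, Nat.Partrec.Code.evaln_complete, Option.isSome_iff_exists]
    simp only [ne_eq, ite_eq_left_iff, one_ne_zero, imp_false, not_not, not_exists]
    simp only [Option.mem_def, Option.not_isSome_iff_eq_none, Option.eq_none_iff_forall_ne_some]
    exact forall_comm
  obtain ⟨S, ⟨β, _, F, hF, h⟩, hS⟩ := hg.exists_isMDefinable R K
  obtain ⟨N, ⟨e⟩⟩ := Finite.exists_equiv_fin (Unit ⊕ β)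
  classical
  refine ⟨N, e (.inl ()), hF.toFinset.image (MvPolynomial.rename (Prod.map e id)), fun hD => ?_⟩
  refine ComputablePred.halting_problem 0 ?_
  have key (c : ℕ) : (∃ x : Fin N → M₂ → K, (x (e (.inl ())) = fun _ => (c : K)) ∧
      ∀ f ∈ hF.toFinset.image (MvPolynomial.rename (Prod.map e id)), MPolynomial.value f x = 0) ↔
      ¬ (Nat.Partrec.Code.eval (Denumerable.ofNat Nat.Partrec.Code c) 0).Dom := by
    rw [← hg0, ← hS, h]
    simp only [Finset.forall_mem_image, Set.Finite.mem_toFinset, MPolynomial.value_rename]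
    constructor
    · rintro ⟨x, hx, hf⟩
      refine ⟨fun b => x (e (.inr b)), fun f hfF => ?_⟩
      convert hf hfF
      ext (_ | _) l
      · simp [hx]
      · rfl
    · rintro ⟨y, hy⟩
      refine ⟨Sum.elim (fun _ _ => (c : K)) y ∘ e.symm, by simp, fun f hfF => ?_⟩
      simpa [Function.comp_assoc] using hy f hfF
  refine ComputablePred.computable_of_manyOneReducible ?_ (hD.of_eq key).not
  -- Encoding passes from programs, for which halting is undecidable, to their numbers.
  exact ⟨Encodable.encode, Computable.encode, fun c => by simp⟩

/-! ### Codes of systems and the reduction -/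

theorem PolyCode.denote_surjective {A : Type*} [CommRing A] {ν : ℕ → A}
    (hν : Function.Surjective ν) : Function.Surjective (PolyCode.denote ν) := by
  intro p
  induction p using MvPolynomial.induction_on' with
  | monomial u a =>
    obtain ⟨j, rfl⟩ := hν a
    refine ⟨[(j, u.support.toList.map fun v => ((v.1, v.2.toList), u v))], ?_⟩
    simp only [PolyCode.denote, TermCode.denote, List.map_cons, List.map_nil, List.sum_cons,
      List.sum_nil, add_zero, List.map_map, MvPolynomial.monomial_eq, Finsupp.prod]
    rw [← Finset.prod_map_toList]
    rfl
  | add p q hp hq =>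
    obtain ⟨c, rfl⟩ := hp
    obtain ⟨d, rfl⟩ := hq
    exact ⟨c ++ d, by simp [PolyCode.denote]⟩

/-- Names of the elements `-n` of a computable field can be computed from `n`. -/
theorem IsComputablePresentation.exists_computable_neg_natCast {A : Type*} [Field A] {ν : ℕ → A}
    (hν : IsComputablePresentation ν) : ∃ f : ℕ → ℕ, Computable f ∧ ∀ n, ν (f n) = -(n : A) := by
  obtain ⟨s, hs, h⟩ := hν.add
  obtain ⟨z, hz⟩ := hν.surjective 0
  obtain ⟨m, hm⟩ := hν.surjective (-1)
  refine ⟨fun n => n.rec z fun _ r => s r m, Computable.nat_rec .id (.const z)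
    (hs.comp (Computable.snd.comp .snd) (.const m)).to₂, fun n => ?_⟩
  induction n with
  | zero => simpa using hz
  | succ n ih =>
    simp only [h, hm, Nat.cast_succ] at ih ⊢
    rw [ih]
    ring

theorem mainTheorem7 {k : Type*} [Field k] [CharZero k] (k₀ : Subfield k) (ν : ℕ → k₀)
    (hν : IsComputablePresentation ν) :
    ¬ M₂SolvabilityDecidable k ν := by
  rintro ⟨D, hD, h⟩
  obtain ⟨N, i, F, hF⟩ := exists_undecidable_system k₀ k
  refine hF (ComputablePred.computable_iff.2 ?_)
  obtain ⟨f, hf, hfν⟩ := hν.exists_computable_neg_natCast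
  obtain ⟨o, ho⟩ := hν.surjective 1
  -- A noncomputable choice is harmless here: only the finitely many codes of the fixed system are
  -- used.
  choose d hd using PolyCode.denote_surjective hν.surjective
  let L : List PolyCode := F.toList.map fun p => d p.includeVars
  -- A code of `X_i - c`, the only member of the system that depends on `c`.
  let q (c : ℕ) : PolyCode := [(o, [(((i : ℕ), []), 1)]), (f c, [])]
  let code (c : ℕ) : SystemCode := (N, q c :: L)
  have h_code : Computable code :=
    .pair (.const N) (Computable.list_cons.comp (Computable.list_cons.comp (.const _)
      (Computable.list_cons.comp (.pair hf (.const [])) (.const []))) (.const L))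
  refine ⟨fun c => D (code c), hD.comp h_code, funext fun c => propext ?_⟩
  classical
  let p : MPolynomial M₂ (Fin N) k₀ := MvPolynomial.X (i, 1) - MvPolynomial.C (c : k₀)
  have hp : (q c).denote ν = p.includeVars := by
    simp [q, p, PolyCode.denote, TermCode.denote, PowerCode.denote, MPolynomial.includeVars, ho,
      hfν, sub_eq_add_neg]
  have hc : (code c).Represents ν (insert p F) := by
    refine ⟨rfl, ?_⟩
    ext r
    simp [code, L, hp, hd, eq_comm]
  rw [h N (insert p F) (code c) hc, HasSequenceSolution]
  have hpx (x : Fin N → M₂ → k) : p.value x = 0 ↔ x i = fun _ => (c : k) := by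
    simp only [p, MPolynomial.value, map_sub, MvPolynomial.aeval_X, map_one, sub_eq_zero, map_natCast]
    rfl
  simp [hpx]
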